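/- Let $\langle x,w\rangle$ denote the usual injective pairing of bit strings (double every bit of $x$, append $01$, append $w$). For a language $V\subseteq\{0,1\}^*$ and a string $w\in\{0,1\}^{k}$ let $V[w]:\{0,1\}^n\to\{0,1\}$ be the function with $V[w](x)=1$ iff $\langle x,w\rangle\in V$ (the function computed on inputs of length $n$ by a machine for $V$ that is given $w$ as advice). For a class $\mathcal{C}$ of languages: - $\mathcal{C}/\mathrm{poly}$ is the class of languages $L$ for which there are $V\in\mathcal{C}$, a polynomial $p$ and advice strings $a_n\in\{0,1\}^{p(n)}$ such that $V[a_n](x)=L(x)$ for all $n\ge 0$ and all $x\in\{0,1\}^n$. - $(\mathsf{AC}^0)^{\text{Untrusted-}\mathcal{C}}$ is the class of languages $L$ for which there are a nonuniform family $(U_n)_{n\ge0}$ of circuits with NOT gates, AND and OR gates of unbounded fan-in, and oracle gates for $m=m(n)$ Boolean functions on $n$ bits, of constant depth and polynomial size (oracle gates included), each circuit outputting $0$, $1$ or FAIL, together with some $V\in\mathcal{C}$ and a polynomial $p$, such that for all $n$: (i) there exist $a_1,\dots,a_m\in\{0,1\}^{p(n)}$ such that $U_n^{V[a_1],\dots,V[a_m]}(x)=L(x)$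 for all $x\in\{0,1\}^n$; (ii) for all $a_1,\dots,a_m\in\{0,1\}^{p(n)}$ and all $x\in\{0,1\}^n$, $U_n^{V[a_1],\dots,V[a_m]}(x)\in\{L(x),\text{FAIL}\}$. **Theorem.** For every class $\mathcal{C}$ of languages (in particular, for the class of languages decided by the machines of any uniform syntactic complexity class), $$\mathcal{C}/\mathrm{poly}\subseteq(\mathsf{AC}^0)^{\text{Untrusted-}\mathcal{C}} .$$ In particular this holds for $\mathcal{C}=\mathsf{P}$, $\mathsf{NP}$ and $\mathsf{EXP}$. -/

import Mathlib

namespace UntrustedOracles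

/-! ### Languages, pairs, and the classes P, NP and EXP -/

/-- The standard self-delimiting pairing of bit strings: every bit of `x` is doubled, then come
the separator `01` and `w`. -/
def pair (x w : List Bool) : List Bool :=
  x.flatMap (fun b => [b, b]) ++ [false, true] ++ w

open Classical in
/-- Some Turing machine decides `L` (it halts on every string `x` with the output `1` if `x ∈ L`
and `0` if not) and makes at most `t |x|` steps on every input `x`. -/
def DecidableInTime (L : Language Bool) (t : ℕ → ℕ) : Prop :=
  ∃ M : Turing.TM2ComputableInTime (id : List Bool → List Bool) Computability.encodeBool
      (fun x : List Bool => decide (x ∈ L)),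
    ∀ n, M.time n ≤ t n

/-- The class `P`. -/
def P : Set (Language Bool) :=
  {L | ∃ p : Polynomial ℕ, DecidableInTime L (fun n => p.eval n)}

/-- The class `NP`: polynomially long witnesses, checked in polynomial time. -/
def NP : Set (Language Bool) :=
  {L | ∃ R ∈ P, ∃ q : Polynomial ℕ, ∀ x : List Bool,
    x ∈ L ↔ ∃ y : List Bool, y.length ≤ q.eval x.length ∧ pair x y ∈ R}

/-- The class `EXP`. -/
def EXP : Set (Language Bool) :=
  {L | ∃ p : Polynomial ℕ, DecidableInTime L (fun n => 2 ^ p.eval n)}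

/-! ### Advice -/

open Classical in
/-- The Boolean function computed on `n`-bit inputs by (the machine that decides) `V`, when the
advice string on this input length is `w`. Since `V` accepts or rejects every string, this
function is defined for every `w`. -/
noncomputable def withAdvice (V : Language Bool) {n k : ℕ} (w : Fin k → Bool)
    (x : Fin n → Bool) : Bool :=
  decide (pair (List.ofFn x) (List.ofFn w) ∈ V)

/-- The class `𝒞/poly`: languages decided by some `V` in `𝒞` with the help of a family of advice
strings `a n` of `p n` bits, for a polynomial `p`. -/
def slashPoly (𝒞 : Set (Language Bool)) : Set (Language Bool) :=
  {L | ∃ V ∈ 𝒞, ∃ p : Polynomial ℕ, ∃ a : (n : ℕ) → Fin (p.eval n) → Bool,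
    ∀ (n : ℕ) (x : Fin n → Bool), withAdvice V (a n) x = true ↔ List.ofFn x ∈ L}

/-! ### Oracle circuits of unbounded fan-in -/

/-- The gates of a circuit on `n` input bits with `m` oracles, each of them a Boolean function on
`n` bits; the wires into a gate come from elements of the set of nodes `N`. -/
inductive Gate (n m : ℕ) (N : Type)
  /-- an input bit -/
  | input (i : Fin n)
  /-- negation -/
  | not (u : N)
  /-- conjunction of arbitrary fan-in (the constant `1` if the fan-in is zero) -/
  | and (S : Finset N)
  /-- disjunction of arbitrary fan-in (the constant `0` if the fan-in is zero) -/
  | or (S : Finset N)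
  /-- the answer of the oracle `j` to the query whose bits are the values of `y 0, …, y (n-1)` -/
  | oracle (j : Fin m) (y : Fin n → N)

namespace Gate

variable {n m : ℕ} {N : Type}

/-- The nodes that feed the gate. -/
def preds : Gate n m N → Set N
  | input _ => ∅
  | not u => {u}
  | and S => S
  | or S => S
  | oracle _ y => Set.range y

/-- The value of the gate on the input `x`, with the oracles `O`, when `v` lists the values of
the nodes that feed it. -/
def value (x : Fin n → Bool) (O : Fin m → (Fin n → Bool) → Bool) (v : N → Bool) :
    Gate n m N → Bool
  | input i => x i
  | not u => !(v u)
  | and S => decide (∀ u ∈ S, v u = true)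
  | or S => decide (∃ u ∈ S, v u = true)
  | oracle j y => O j (fun i => v (y i))

theorem value_congr (x : Fin n → Bool) (O : Fin m → (Fin n → Bool) → Bool) {v v' : N → Bool}
    (g : Gate n m N) (h : ∀ u ∈ g.preds, v u = v' u) : g.value x O v = g.value x O v' := by
  cases g with
  | input i => rfl
  | not u => simp [value, h u rfl]
  | and S =>
    have h' : ∀ u ∈ S, v u = v' u := h
    simp +contextual [value, h']
  | or S =>
    have h' : ∀ u ∈ S, v u = v' u := h
    simp only [value, decide_eq_decide]
    exact exists_congr fun u => and_congr_right fun hu => by rw [h' u hu]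
  | oracle j y =>
    simp only [value]
    congr 1
    funext i
    exact h (y i) ⟨i, rfl⟩

end Gate

/-- A circuit on `n` input bits with `m` oracles: a finite directed acyclic graph of gates, with
two output nodes. The levels increase along wires, so they witness acyclicity, and the number
of wires on a path is at most the level of its last node. -/
structure OracleCircuit (n m : ℕ) where
  /-- the nodes -/
  Node : Type
  [nodeFintype : Fintype Node]
  /-- the gate at each node -/
  gate : Node → Gate n m Node
  /-- the level of each node -/
  level : Node → ℕ
  level_lt : ∀ u, ∀ v ∈ (gate u).preds, level v < level u
  /-- the output node that signals failure -/
  failNode : Node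
  /-- the output node that holds the answer -/
  answerNode : Node

namespace OracleCircuit

variable {n m : ℕ} (U : OracleCircuit n m)

/-- The number of gates. -/
def size : ℕ := @Fintype.card U.Node U.nodeFintype

/-- The greatest level. -/
def depth : ℕ := (@Finset.univ U.Node U.nodeFintype).sup U.level

/-- The values of the nodes; the side condition in the recursion always holds for the nodes that
matter, see `eval_eq`. -/
def eval (x : Fin n → Bool) (O : Fin m → (Fin n → Bool) → Bool) (u : U.Node) : Bool :=
  (U.gate u).value x O (fun v => if _h : U.level v < U.level u then eval x O v else false)
termination_by U.level u

theorem eval_eq (x : Fin n → Bool) (O : Fin m → (Fin n → Bool) → Bool) (u : U.Node) :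
    U.eval x O u = (U.gate u).value x O (U.eval x O) := by
  rw [eval]
  exact Gate.value_congr x O _ fun v hv => by simp [U.level_lt u v hv]

/-- The output of the circuit: `none` stands for `FAIL`, and `some b` for the answer `b`. -/
def output (x : Fin n → Bool) (O : Fin m → (Fin n → Bool) → Bool) : Option Bool :=
  if U.eval x O U.failNode = true then none else some (U.eval x O U.answerNode)

end OracleCircuit

/-! ### Untrusted oracles -/

open Classical in
/-- The class `(AC⁰)^{Untrusted-𝒟}`. A language `L` belongs to it if there are a (nonuniform)
family of oracle circuits `U n` of constant depth and polynomial size, some `V` in `𝒟`, and a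
polynomial `p`, such that for every `n`:
* some `p n`-bit advice strings `a₁, …, aₘ` make `U n` with the oracles `V[a₁], …, V[aₘ]` output
  `L x` for all `x` of `n` bits;
* for all `p n`-bit advice strings `a₁, …, aₘ` and all `x` of `n` bits, `U n` with the oracles
  `V[a₁], …, V[aₘ]` outputs `L x` or `FAIL`. -/
def AC0Untrusted (𝒟 : Set (Language Bool)) : Set (Language Bool) :=
  {L | ∃ (m : ℕ → ℕ) (U : (n : ℕ) → OracleCircuit n (m n)) (d : ℕ) (s : Polynomial ℕ),
    (∀ n, (U n).depth ≤ d ∧ (U n).size ≤ s.eval n) ∧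
    ∃ V ∈ 𝒟, ∃ p : Polynomial ℕ, ∀ n : ℕ,
      (∃ a : Fin (m n) → Fin (p.eval n) → Bool, ∀ x : Fin n → Bool,
        (U n).output x (fun j => withAdvice V (a j)) = some (decide (List.ofFn x ∈ L))) ∧
      (∀ (a : Fin (m n) → Fin (p.eval n) → Bool) (x : Fin n → Bool),
        (U n).output x (fun j => withAdvice V (a j)) = some (decide (List.ofFn x ∈ L)) ∨
        (U n).output x (fun j => withAdvice V (a j)) = none)}

end UntrustedOracles

namespace UntrustedOracles

/-! ### Certificates that isolate a member of a family of Boolean functions -/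

section Certificates

open Finset
open scoped Classical

variable {W X : Type}

/-! Each oracle is guarded by a hard-wired certificate. If a few points determine a function within
the family of all `V[w]`, a circuit can query an oracle there, fail on any unexpected answer, and
otherwise trust the oracle everywhere. The correct function need not be isolated in this sense, but
it is an OR of ANDs of isolated members (`exists_disjunction_of_conjunctions`), which constant depth
can evaluate.

The family has at most `2 ^ k` members, so greedy sampling (`exists_agreement_set`) finds few points
where agreement with the target forces agreement on most of a prescribed set. Repeatedly halving the
survivors (`exists_isolating_set`) isolates one of them. The resulting functions are close to the
target on two sets at once (`exists_isIsolated_close`): ANDing them removes all false positives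
while keeping half of the points still to be covered, and ORing such conjunctions covers everything.
-/

theorem two_mul_pow_le_succ_pow (M : ℕ) (hM : 0 < M) :
    2 * M ^ (M + 1) ≤ (M + 1) ^ (M + 1) := by
  -- Bernoulli's inequality `1 + j / M ≤ (1 + 1 / M) ^ j` without denominators; it is used at `j = M
  -- + 1`.
  have key : ∀ j : ℕ, M ^ j * (M + j) ≤ M * (M + 1) ^ j := by
    intro j
    induction j with
    | zero => simp
    | succ j ih =>
      calc M ^ (j + 1) * (M + (j + 1)) ≤ (M ^ j * (M + j)) * (M + 1) := by
            rw [pow_succ, mul_assoc, mul_assoc]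
            exact Nat.mul_le_mul_left _ (by nlinarith)
        _ ≤ (M * (M + 1) ^ j) * (M + 1) := Nat.mul_le_mul_right _ ih
        _ = M * (M + 1) ^ (j + 1) := by ring
  refine Nat.le_of_mul_le_mul_left ?_ hM
  calc M * (2 * M ^ (M + 1)) = M ^ (M + 1) * (M + M) := by ring
    _ ≤ M ^ (M + 1) * (M + (M + 1)) := Nat.mul_le_mul_left _ (by omega)
    _ ≤ M * (M + 1) ^ (M + 1) := key _

/-- A greedily chosen point rules out a fixed fraction of the functions that are far from `f`. -/
theorem exists_agreement_set_of_steps [Fintype W] (F : W → X → Bool) (f : X → Bool) (A : Finset X)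
    (M t : ℕ) :
    ∃ C : Finset X, #C ≤ t ∧
      #{w : W | (∀ x ∈ C, F w x = f x) ∧ #A < (M + 1) * #{x ∈ A | F w x ≠ f x}} * (M + 1) ^ t
        ≤ M ^ t * Fintype.card W := by
  induction t with
  | zero => exact ⟨∅, by simp, by simpa using Finset.card_le_univ _⟩
  | succ t ih =>
    obtain ⟨C, hC, hb⟩ := ih
    set D : Finset W :=
      {w : W | (∀ x ∈ C, F w x = f x) ∧ #A < (M + 1) * #{x ∈ A | F w x ≠ f x}} with hD
    -- Averaging needs a nonempty `A`; over the empty set the strict inequality leaves no function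
    -- to count.
    rcases A.eq_empty_or_nonempty with rfl | hA
    · exact ⟨∅, by simp, by simp⟩
    -- Double counting: each function in `D` errs on more than `1 / (M + 1)` of `A`, so some point
    -- of `A` rules out at least that fraction of `D`.
    have hsum : ∑ _x ∈ A, #D ≤ ∑ x ∈ A, (M + 1) * #{w ∈ D | F w x ≠ f x} := by
      have hswap : ∑ x ∈ A, #{w ∈ D | F w x ≠ f x} = ∑ w ∈ D, #{x ∈ A | F w x ≠ f x} := by
        simp only [Finset.card_filter]
        exact Finset.sum_comm
      rw [← Finset.mul_sum, hswap, Finset.mul_sum, Finset.sum_const, smul_eq_mul, mul_comm,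
        ← smul_eq_mul, ← Finset.sum_const]
      refine Finset.sum_le_sum fun w hw => ?_
      exact (Finset.mem_filter.mp hw).2.2.le
    obtain ⟨x, -, hx⟩ := Finset.exists_le_of_sum_le hA hsum
    refine ⟨insert x C, (Finset.card_insert_le _ _).trans (by omega), ?_⟩
    set D' : Finset W := {w : W | (∀ y ∈ insert x C, F w y = f y) ∧
      #A < (M + 1) * #{y ∈ A | F w y ≠ f y}} with hD'
    have hsub : D' ⊆ {w ∈ D | ¬ F w x ≠ f x} := by
      intro w hw
      simp only [hD', hD, Finset.mem_filter, Finset.mem_univ, true_and,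
        Finset.mem_insert, forall_eq_or_imp] at hw ⊢
      exact ⟨⟨hw.1.2, hw.2⟩, not_not.mpr hw.1.1⟩
    have hcard := Finset.card_filter_add_card_filter_not (s := D) (fun w => F w x ≠ f x)
    have hle := Finset.card_le_card hsub
    have hstep : #D' * (M + 1) ≤ M * #D := by nlinarith
    calc #D' * (M + 1) ^ (t + 1) = (#D' * (M + 1)) * (M + 1) ^ t := by ring
      _ ≤ (M * #D) * (M + 1) ^ t := Nat.mul_le_mul_right _ hstep
      _ = M * (#D * (M + 1) ^ t) := by ring
      _ ≤ M * (M ^ t * Fintype.card W) := Nat.mul_le_mul_left _ hb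
      _ = M ^ (t + 1) * Fintype.card W := by ring

/-- There is a small set `C` such that every function of the family that agrees with `f` on `C`
agrees with `f` on all but a fraction `1 / (M + 1)` of `A`. -/
theorem exists_agreement_set [Fintype W] (F : W → X → Bool) (f : X → Bool) (A : Finset X) {M k : ℕ}
    (hM : 0 < M) (hW : Fintype.card W ≤ 2 ^ k) :
    ∃ C : Finset X, #C ≤ (M + 1) * (k + 1) ∧ ∀ w, (∀ x ∈ C, F w x = f x) →
      (M + 1) * #{x ∈ A | F w x ≠ f x} ≤ #A := by
  obtain ⟨C, hC, hb⟩ := exists_agreement_set_of_steps F f A M ((M + 1) * (k + 1))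
  refine ⟨C, hC, fun w hw => ?_⟩
  by_contra! hlt
  set D : Finset W :=
    {w : W | (∀ x ∈ C, F w x = f x) ∧ #A < (M + 1) * #{x ∈ A | F w x ≠ f x}}
  have hpos : 1 ≤ #D :=
    Finset.card_pos.mpr ⟨w, Finset.mem_filter.mpr ⟨Finset.mem_univ _, hw, hlt⟩⟩
  -- The rounds form `k + 1` blocks of `M + 1`, and each block at least halves the bad functions;
  -- fewer than one of `2 ^ k` is left.
  have hpow : 2 ^ (k + 1) * M ^ ((M + 1) * (k + 1)) ≤ (M + 1) ^ ((M + 1) * (k + 1)) := by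
    rw [pow_mul, pow_mul, ← mul_pow]
    exact Nat.pow_le_pow_left (two_mul_pow_le_succ_pow M hM) _
  have hMt : 0 < M ^ ((M + 1) * (k + 1)) := pow_pos hM _
  have h1 : M ^ ((M + 1) * (k + 1)) * 2 ^ (k + 1) ≤ M ^ ((M + 1) * (k + 1)) * 2 ^ k :=
    calc M ^ ((M + 1) * (k + 1)) * 2 ^ (k + 1)
        = 2 ^ (k + 1) * M ^ ((M + 1) * (k + 1)) := mul_comm _ _
      _ ≤ 1 * (M + 1) ^ ((M + 1) * (k + 1)) := by rw [one_mul]; exact hpow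
      _ ≤ #D * (M + 1) ^ ((M + 1) * (k + 1)) := Nat.mul_le_mul_right _ hpos
      _ ≤ M ^ ((M + 1) * (k + 1)) * Fintype.card W := hb
      _ ≤ M ^ ((M + 1) * (k + 1)) * 2 ^ k := Nat.mul_le_mul_left _ hW
  have h2 := Nat.le_of_mul_le_mul_left h1 hMt
  have h3 : 0 < 2 ^ k := by positivity
  rw [pow_succ] at h2
  omega

/-! ### Isolated functions -/

/-- Some member of a family of at most `2 ^ k` functions is determined by its values on `k`
points. -/
theorem exists_isolating_set (F : W → X → Bool) (k : ℕ) (T : Finset W) (hT : T.Nonempty)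
    (hk : #T ≤ 2 ^ k) :
    ∃ C : Finset X, #C ≤ k ∧ ∃ w₁ ∈ T, ∀ w ∈ T, (∀ x ∈ C, F w x = F w₁ x) → F w = F w₁ := by
  induction k generalizing T with
  | zero =>
    obtain ⟨w₁, h₁⟩ := hT
    refine ⟨∅, by simp, w₁, h₁, fun w hw _ => ?_⟩
    rw [Finset.card_le_one.mp (by simpa using hk) w hw w₁ h₁]
  | succ k ih =>
    by_cases hall : ∀ w ∈ T, ∀ w' ∈ T, F w = F w'
    · obtain ⟨w₁, h₁⟩ := hT
      exact ⟨∅, by simp, w₁, h₁, fun w hw _ => hall w hw w₁ h₁⟩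
    push Not at hall
    obtain ⟨u, hu, u', hu', hne⟩ := hall
    obtain ⟨x, hx⟩ := Function.ne_iff.mp hne
    -- Keep the rarer answer at `x`; since `u` and `u'` differ there, both answers occur.
    obtain ⟨b, hb⟩ : ∃ b : Bool, #{w ∈ T | F w x = b} ≤ 2 ^ k := by
      have hcard := Finset.card_filter_add_card_filter_not (s := T) (fun w => F w x = true)
      simp only [Bool.not_eq_true] at hcard
      rw [pow_succ] at hk
      by_contra! h
      have := h true
      have := h false
      omega
    have hne' : ({w ∈ T | F w x = b} : Finset W).Nonempty := by
      by_cases h : F u x = b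
      · exact ⟨u, Finset.mem_filter.mpr ⟨hu, h⟩⟩
      · refine ⟨u', Finset.mem_filter.mpr ⟨hu', ?_⟩⟩
        revert h hx
        cases F u x <;> cases F u' x <;> cases b <;> simp
    obtain ⟨C, hC, w₁, h₁, hiso⟩ := ih _ hne' hb
    rw [Finset.mem_filter] at h₁
    refine ⟨insert x C, (Finset.card_insert_le _ _).trans (by omega), w₁, h₁.1,
      fun w hw hagree => hiso w (Finset.mem_filter.mpr ⟨hw, ?_⟩) fun y hy =>
        hagree y (Finset.mem_insert_of_mem hy)⟩
    rw [hagree x (Finset.mem_insert_self _ _), h₁.2]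

/-- The function `F w` is determined, within the family `F`, by its values on some `c` points. -/
def IsIsolated (F : W → X → Bool) (c : ℕ) (w : W) : Prop :=
  ∃ C : Finset X, #C ≤ c ∧ ∀ w', (∀ x ∈ C, F w' x = F w x) → F w' = F w

/-- Some isolated function is close to `f` on two given sets at once. -/
theorem exists_isIsolated_close [Fintype W] (F : W → X → Bool) (w₀ : W) (A B : Finset X) {M k : ℕ}
    (hM : 0 < M) (hW : Fintype.card W ≤ 2 ^ k) :
    ∃ w, IsIsolated F (2 * ((M + 1) * (k + 1)) + k) w ∧
      (M + 1) * #{x ∈ A | F w x ≠ F w₀ x} ≤ #A ∧ (M + 1) * #{x ∈ B | F w x ≠ F w₀ x} ≤ #B := by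
  obtain ⟨CA, hCA, hA⟩ := exists_agreement_set F (F w₀) A hM hW
  obtain ⟨CB, hCB, hB⟩ := exists_agreement_set F (F w₀) B hM hW
  obtain ⟨C, hC, w₁, h₁, hiso⟩ := exists_isolating_set F k
    {w : W | ∀ x ∈ CA ∪ CB, F w x = F w₀ x} ⟨w₀, by simp⟩ ((Finset.card_le_univ _).trans hW)
  simp only [Finset.mem_filter, Finset.mem_univ, true_and] at h₁ hiso
  -- The certificate includes `CA ∪ CB`, which excludes competitors outside the subfamily and so
  -- isolates `w₁` in the whole family.
  refine ⟨w₁, ⟨CA ∪ CB ∪ C, ?_, fun w hw => hiso w (fun x hx => ?_) fun x hx => ?_⟩,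
    hA w₁ fun x hx => h₁ x (Finset.mem_union_left _ hx),
    hB w₁ fun x hx => h₁ x (Finset.mem_union_right _ hx)⟩
  · have := Finset.card_union_le (CA ∪ CB) C
    have := Finset.card_union_le CA CB
    omega
  · rw [hw x (Finset.mem_union_left _ hx), h₁ x hx]
  · exact hw x (Finset.mem_union_right _ hx)

/-! ### Conjunctions and disjunctions of isolated functions -/

/-- A conjunction of `r` isolated functions with few false positives that misses only a small part
of `B`. -/
theorem exists_conjunction_of_length [Fintype W] [Fintype X] (F : W → X → Bool) (w₀ : W) (B : Finset X)
    (hB : ∀ x ∈ B, F w₀ x = true) {M k : ℕ} (hM : 0 < M) (hW : Fintype.card W ≤ 2 ^ k) (r : ℕ) :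
    ∃ l : List W, l.length = r ∧ (∀ w ∈ l, IsIsolated F (2 * ((M + 1) * (k + 1)) + k) w) ∧
      #{x | F w₀ x = false ∧ ∀ w ∈ l, F w x = true} * 2 ^ r ≤ Fintype.card X ∧
      (M + 1) * #{x ∈ B | ∃ w ∈ l, F w x = false} ≤ r * #B := by
  induction r with
  | zero => exact ⟨[], rfl, by simp, by simpa using Finset.card_le_univ _, by simp⟩
  | succ r ih =>
    obtain ⟨l, hl, hiso, hpos, hneg⟩ := ih
    set A : Finset X := {x | F w₀ x = false ∧ ∀ w ∈ l, F w x = true} with hAdef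
    -- `A` shrinks to the remaining false positives in each round, while `B` stays fixed: false
    -- positives halve, and losses on `B` only add up.
    obtain ⟨w₁, h₁, hA₁, hB₁⟩ := exists_isIsolated_close F w₀ A B hM hW
    refine ⟨w₁ :: l, by simp [hl], ?_, ?_, ?_⟩
    · intro w hw
      rcases List.mem_cons.mp hw with rfl | hw
      · exact h₁
      · exact hiso w hw
    · have hsub : ({x | F w₀ x = false ∧ ∀ w ∈ w₁ :: l, F w x = true} : Finset X) ⊆
          {x ∈ A | F w₁ x ≠ F w₀ x} := by
        intro x hx
        simp only [hAdef, Finset.mem_filter, Finset.mem_univ, true_and, List.mem_cons,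
          forall_eq_or_imp] at hx ⊢
        exact ⟨⟨hx.1, hx.2.2⟩, by simp [hx.1, hx.2.1]⟩
      have hle := Finset.card_le_card hsub
      have hhalf : #({x | F w₀ x = false ∧ ∀ w ∈ w₁ :: l, F w x = true} : Finset X) * 2 ≤ #A := by
        nlinarith
      calc _ = (#({x | F w₀ x = false ∧ ∀ w ∈ w₁ :: l, F w x = true} : Finset X) * 2) * 2 ^ r := by
            rw [pow_succ]; ring
        _ ≤ #A * 2 ^ r := Nat.mul_le_mul_right _ hhalf
        _ ≤ _ := hpos
    · have hsub : {x ∈ B | ∃ w ∈ w₁ :: l, F w x = false} ⊆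
          {x ∈ B | F w₁ x ≠ F w₀ x} ∪ {x ∈ B | ∃ w ∈ l, F w x = false} := by
        intro x hx
        simp only [Finset.mem_filter, Finset.mem_union, List.mem_cons, exists_eq_or_imp] at hx ⊢
        rcases hx.2 with h | h
        · exact Or.inl ⟨hx.1, by simp [h, hB x hx.1]⟩
        · exact Or.inr ⟨hx.1, h⟩
      have hle := (Finset.card_le_card hsub).trans (Finset.card_union_le _ _)
      calc _ ≤ (M + 1) * _ := Nat.mul_le_mul_left _ hle
        _ ≤ #B + r * #B := by rw [mul_add]; exact Nat.add_le_add hB₁ hneg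
        _ = (r + 1) * #B := by ring

/-- A conjunction of isolated functions without false positives that covers half of `B`. -/
theorem exists_conjunction [Fintype W] [Fintype X] (F : W → X → Bool) (w₀ : W) (B : Finset X)
    (hB : ∀ x ∈ B, F w₀ x = true) {n k : ℕ} (hX : Fintype.card X ≤ 2 ^ n)
    (hW : Fintype.card W ≤ 2 ^ k) :
    ∃ l : List W, l.length = n + 1 ∧
      (∀ w ∈ l, IsIsolated F (2 * ((2 * n + 2) * (k + 1)) + k) w) ∧
      (∀ x, (∀ w ∈ l, F w x = true) → F w₀ x = true) ∧
      #{x ∈ B | ∃ w ∈ l, F w x = false} * 2 ≤ #B := by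
  obtain ⟨l, hl, hiso, hpos, hneg⟩ :=
    -- With `M + 1 = 2 * n + 2`, the `n + 1` losses total at most half of `B`; `n + 1` halvings
    -- leave no false positive among `2 ^ n` points.
    exists_conjunction_of_length F w₀ B hB (M := 2 * n + 1) (by omega) hW (n + 1)
  refine ⟨l, hl, hiso, fun x hx => ?_, ?_⟩
  · by_contra hf
    have h1 : 1 ≤ #{x | F w₀ x = false ∧ ∀ w ∈ l, F w x = true} :=
      Finset.card_pos.mpr ⟨x, by simpa using ⟨by simpa using hf, hx⟩⟩
    have h2 := (Nat.mul_le_mul_right (2 ^ (n + 1)) h1).trans (hpos.trans hX)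
    have h3 : 0 < 2 ^ n := by positivity
    rw [pow_succ] at h2
    omega
  · refine Nat.le_of_mul_le_mul_left ?_ (Nat.succ_pos n)
    calc _ = (2 * n + 1 + 1) * #{x ∈ B | ∃ w ∈ l, F w x = false} := by rw [Nat.succ_eq_add_one]; ring
      _ ≤ _ := hneg

/-- Greedy covering: each new conjunction is applied to the accepted points still missed and halves
them. -/
theorem exists_disjunction_of_length [Fintype W] [Fintype X] (F : W → X → Bool) (w₀ : W) {n k : ℕ}
    (hX : Fintype.card X ≤ 2 ^ n) (hW : Fintype.card W ≤ 2 ^ k) (r : ℕ) :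
    ∃ ls : List (List W), ls.length = r ∧ (∀ l ∈ ls, l.length = n + 1 ∧
      (∀ w ∈ l, IsIsolated F (2 * ((2 * n + 2) * (k + 1)) + k) w) ∧
      ∀ x, (∀ w ∈ l, F w x = true) → F w₀ x = true) ∧
      #{x | F w₀ x = true ∧ ∀ l ∈ ls, ∃ w ∈ l, F w x = false} * 2 ^ r ≤ Fintype.card X := by
  induction r with
  | zero => exact ⟨[], rfl, by simp, by simpa using Finset.card_le_univ _⟩
  | succ r ih =>
    obtain ⟨ls, hls, hall, hcov⟩ := ih
    set B : Finset X := {x | F w₀ x = true ∧ ∀ l ∈ ls, ∃ w ∈ l, F w x = false} with hBdef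
    obtain ⟨l, hl, hiso, hpos, hhalf⟩ :=
      exists_conjunction F w₀ B (fun x hx => (Finset.mem_filter.mp hx).2.1) hX hW
    refine ⟨l :: ls, by simp [hls], ?_, ?_⟩
    · intro l' hl'
      rcases List.mem_cons.mp hl' with rfl | hl'
      · exact ⟨hl, hiso, hpos⟩
      · exact hall l' hl'
    · have hsub : ({x | F w₀ x = true ∧ ∀ l' ∈ l :: ls, ∃ w ∈ l', F w x = false} : Finset X) ⊆
          {x ∈ B | ∃ w ∈ l, F w x = false} := by
        intro x hx
        simp only [hBdef, Finset.mem_filter, Finset.mem_univ, true_and, List.mem_cons,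
          forall_eq_or_imp] at hx ⊢
        exact ⟨⟨hx.1, hx.2.2⟩, hx.2.1⟩
      rw [pow_succ, mul_comm (2 ^ r), ← mul_assoc]
      exact (Nat.mul_le_mul_right _
        ((Nat.mul_le_mul_right _ (Finset.card_le_card hsub)).trans hhalf)).trans hcov

/-- Every member of a family is a disjunction of conjunctions of isolated members. -/
theorem exists_disjunction_of_conjunctions [Fintype W] [Fintype X] (F : W → X → Bool) (w₀ : W) {n k : ℕ}
    (hX : Fintype.card X ≤ 2 ^ n) (hW : Fintype.card W ≤ 2 ^ k) :
    ∃ a : Fin (n + 1) → Fin (n + 1) → W,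
      (∀ i j, IsIsolated F (2 * ((2 * n + 2) * (k + 1)) + k) (a i j)) ∧
      ∀ x, F w₀ x = true ↔ ∃ i, ∀ j, F (a i j) x = true := by
  obtain ⟨ls, hls, hall, hcov⟩ := exists_disjunction_of_length F w₀ hX hW (n + 1)
  have hmem : ∀ i : Fin (n + 1), ls.get (i.cast hls.symm) ∈ ls := fun i => List.get_mem _ _
  have hlen : ∀ i : Fin (n + 1), (ls.get (i.cast hls.symm)).length = n + 1 :=
    fun i => (hall _ (hmem i)).1
  refine ⟨fun i j => (ls.get (i.cast hls.symm)).get (j.cast (hlen i).symm),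
    fun i j => (hall _ (hmem i)).2.1 _ (List.get_mem _ _), fun x => ⟨fun hx => ?_, ?_⟩⟩
  · by_contra! hno
    have h1 : 1 ≤ #{x | F w₀ x = true ∧ ∀ l ∈ ls, ∃ w ∈ l, F w x = false} := by
      refine Finset.card_pos.mpr ⟨x, Finset.mem_filter.mpr ⟨Finset.mem_univ _, hx, ?_⟩⟩
      intro l hl
      obtain ⟨i, rfl⟩ := List.get_of_mem hl
      obtain ⟨j, hj⟩ := hno (i.cast hls)
      exact ⟨_, List.get_mem _ _, (Bool.not_eq_true _).mp hj⟩
    have h2 := (Nat.mul_le_mul_right (2 ^ (n + 1)) h1).trans (hcov.trans hX)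
    have h3 : 0 < 2 ^ n := by positivity
    rw [pow_succ] at h2
    omega
  · rintro ⟨i, hi⟩
    refine (hall _ (hmem i)).2.2 x fun w hw => ?_
    obtain ⟨j, rfl⟩ := List.get_of_mem hw
    exact hi (j.cast (hlen i))

/-- The points that isolate a function, listed with repetitions. -/
theorem IsIsolated.exists_queries [Nonempty X] {F : W → X → Bool} {c : ℕ} {w : W}
    (h : IsIsolated F c w) :
    ∃ q : Fin c → X, ∀ w', (∀ i, F w' (q i) = F w (q i)) → F w' = F w := by
  obtain ⟨C, hC, hiso⟩ := h
  obtain ⟨x₀⟩ := ‹Nonempty X›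
  -- Padding with `x₀` is harmless: extra queries only strengthen the agreement hypothesis.
  refine ⟨fun i => C.toList.getD i x₀, fun w' hw' => hiso w' fun x hx => ?_⟩
  obtain ⟨i, hi, rfl⟩ := List.getElem_of_mem (Finset.mem_toList.mpr hx)
  have hi' : i < c := lt_of_lt_of_le (by simpa using hi) hC
  have h := hw' ⟨i, hi'⟩
  simpa only [List.getD_eq_getElem _ _ hi] using h

end Certificates

/-! ### The circuit that checks the certificates and evaluates a disjunction of conjunctions -/

namespace OracleCircuit

variable (n m s c : ℕ)

/-- Nodes of the circuit: constants, inputs, oracle answers on the input, oracle answers on the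
fixed queries, their negations, conjunctions, and the two outputs. -/
abbrev CheckedNode : Type :=
  Bool ⊕ Fin n ⊕ Fin m ⊕ (Fin m × Fin c) ⊕ (Fin m × Fin c) ⊕ Fin s ⊕ Bool

variable {n m s c}

namespace CheckedNode

abbrev const (b : Bool) : CheckedNode n m s c := .inl b
abbrev bit (i : Fin n) : CheckedNode n m s c := .inr (.inl i)
abbrev answer (j : Fin m) : CheckedNode n m s c := .inr (.inr (.inl j))
abbrev test (t : Fin m × Fin c) : CheckedNode n m s c := .inr (.inr (.inr (.inl t)))
abbrev negTest (t : Fin m × Fin c) : CheckedNode n m s c := .inr (.inr (.inr (.inr (.inl t))))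
abbrev conj (i : Fin s) : CheckedNode n m s c := .inr (.inr (.inr (.inr (.inr (.inl i)))))
/-- The output nodes: `out true` signals failure and `out false` holds the answer. -/
abbrev out (b : Bool) : CheckedNode n m s c := .inr (.inr (.inr (.inr (.inr (.inr b)))))

open Classical in
/-- The gates of the circuit; `r t` is the expected answer to the query `q t`. -/
noncomputable def gate (q : Fin m × Fin c → Fin n → Bool) (r : Fin m × Fin c → Bool)
    (e : Fin s → Fin s → Fin m) : CheckedNode n m s c → Gate n m (CheckedNode n m s c)
  | .inl b => if b then .and ∅ else .or ∅
  | .inr (.inl i) => .input i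
  | .inr (.inr (.inl j)) => .oracle j bit
  | .inr (.inr (.inr (.inl t))) => .oracle t.1 fun i => const (q t i)
  | .inr (.inr (.inr (.inr (.inl t)))) => .not (test t)
  | .inr (.inr (.inr (.inr (.inr (.inl i))))) => .and (Finset.univ.image fun j => answer (e i j))
  | .inr (.inr (.inr (.inr (.inr (.inr b))))) =>
    -- The chosen literal is true exactly when the test `t` gets the wrong answer.
    if b then .or (Finset.univ.image fun t => if r t then negTest t else test t)
    else .or (Finset.univ.image conj)

/-- The levels of the circuit. -/
def level : CheckedNode n m s c → ℕ
  | .inl _ => 0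
  | .inr (.inl _) => 0
  | .inr (.inr (.inl _)) => 1
  | .inr (.inr (.inr (.inl _))) => 1
  | .inr (.inr (.inr (.inr (.inl _)))) => 2
  | .inr (.inr (.inr (.inr (.inr (.inl _))))) => 2
  | .inr (.inr (.inr (.inr (.inr (.inr _))))) => 3

end CheckedNode

open CheckedNode

/-- The circuit that fails unless the oracle `t.1` answers the query `q t` with `r t`, for all `t`,
and outputs the disjunction over `i` of the conjunctions over `j` of the answers of the oracles
`e i j` on the input. -/
noncomputable def checked (q : Fin m × Fin c → Fin n → Bool) (r : Fin m × Fin c → Bool)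
    (e : Fin s → Fin s → Fin m) : OracleCircuit n m where
  Node := CheckedNode n m s c
  gate := CheckedNode.gate q r e
  level := CheckedNode.level
  level_lt := by
    rintro (b | i | j | t | t | i | b) v hv
    · cases b <;> simp [CheckedNode.gate, Gate.preds] at hv
    · simp [CheckedNode.gate, Gate.preds] at hv
    · obtain ⟨i, rfl⟩ := hv
      simp [CheckedNode.level]
    · obtain ⟨i, rfl⟩ := hv
      simp [CheckedNode.level]
    · obtain rfl : v = test t := hv
      simp [CheckedNode.level]
    · simp only [CheckedNode.gate, Gate.preds, Finset.coe_image, Set.mem_image] at hv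
      obtain ⟨j, -, rfl⟩ := hv
      simp [CheckedNode.level]
    · cases b
      · simp only [CheckedNode.gate, Gate.preds, Bool.false_eq_true, if_false, Finset.coe_image,
          Set.mem_image] at hv
        obtain ⟨j, -, rfl⟩ := hv
        simp [CheckedNode.level]
      · simp only [CheckedNode.gate, Gate.preds, if_true, Finset.coe_image, Set.mem_image] at hv
        obtain ⟨t, -, rfl⟩ := hv
        split_ifs <;> simp [CheckedNode.level]
  failNode := out true
  answerNode := out false

variable (q : Fin m × Fin c → Fin n → Bool) (r : Fin m × Fin c → Bool)
  (e : Fin s → Fin s → Fin m)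

theorem depth_checked : (checked q r e).depth ≤ 3 := by
  refine Finset.sup_le fun u _ => ?_
  rcases u with b | i | j | t | t | i | b <;> simp [checked, CheckedNode.level]

theorem size_checked : (checked q r e).size = 4 + n + m + 2 * (m * c) + s := by
  have h : (checked q r e).size = Fintype.card (CheckedNode n m s c) := rfl
  rw [h]
  simp only [Fintype.card_sum, Fintype.card_bool, Fintype.card_fin, Fintype.card_prod]
  ring

variable (x : Fin n → Bool) (O : Fin m → (Fin n → Bool) → Bool)

/-- The value of a node of the circuit `checked q r e`. -/
noncomputable def checkedVal (u : CheckedNode n m s c) : Bool :=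
  (checked q r e).eval x O u

theorem checkedVal_eq (u : CheckedNode n m s c) :
    checkedVal q r e x O u = (CheckedNode.gate q r e u).value x O (checkedVal q r e x O) :=
  eval_eq (checked q r e) x O u

theorem checkedVal_const (b : Bool) : checkedVal q r e x O (const b) = b := by
  rw [checkedVal_eq]
  cases b <;> simp [CheckedNode.gate, Gate.value]

theorem checkedVal_bit (i : Fin n) : checkedVal q r e x O (bit i) = x i := by
  rw [checkedVal_eq]
  rfl

theorem checkedVal_answer (j : Fin m) : checkedVal q r e x O (answer j) = O j x := by
  rw [checkedVal_eq]
  simp only [CheckedNode.gate, Gate.value, checkedVal_bit]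

theorem checkedVal_test (t : Fin m × Fin c) :
    checkedVal q r e x O (test t) = O t.1 (q t) := by
  rw [checkedVal_eq]
  simp only [CheckedNode.gate, Gate.value, checkedVal_const]

theorem checkedVal_negTest (t : Fin m × Fin c) :
    checkedVal q r e x O (negTest t) = !(O t.1 (q t)) := by
  rw [checkedVal_eq]
  simp only [CheckedNode.gate, Gate.value, checkedVal_test]

theorem checkedVal_conj (i : Fin s) :
    checkedVal q r e x O (conj i) = true ↔ ∀ j, O (e i j) x = true := by
  rw [checkedVal_eq]
  simp [CheckedNode.gate, Gate.value, checkedVal_answer]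

theorem checkedVal_out_false :
    checkedVal q r e x O (out false) = true ↔ ∃ i, ∀ j, O (e i j) x = true := by
  rw [checkedVal_eq]
  simp only [← checkedVal_conj q r e x O]
  simp [CheckedNode.gate, Gate.value]

theorem checkedVal_out_true :
    checkedVal q r e x O (out true) = true ↔ ∃ t, O t.1 (q t) ≠ r t := by
  have h : ∀ t, checkedVal q r e x O (if r t then negTest t else test t) = true ↔
      O t.1 (q t) ≠ r t := by
    intro t
    cases hr : r t
    · simp [checkedVal_test]
    · simp [checkedVal_negTest]
  rw [checkedVal_eq]
  simp only [← h]
  simp only [CheckedNode.gate, Gate.value, if_true, decide_eq_true_eq, Finset.mem_image,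
    Finset.mem_univ, true_and, exists_exists_eq_and]

theorem output_checked : (checked q r e).output x O =
    if checkedVal q r e x O (out true) = true then none
    else some (checkedVal q r e x O (out false)) := rfl

theorem output_checked_of_forall {b : Bool} (hq : ∀ t, O t.1 (q t) = r t)
    (hb : b = true ↔ ∃ i, ∀ j, O (e i j) x = true) :
    (checked q r e).output x O = some b := by
  rw [output_checked, if_neg (by simpa [checkedVal_out_true] using hq), Option.some_inj,
    Bool.eq_iff_iff, checkedVal_out_false, hb]

theorem output_checked_of_exists (hq : ∃ t, O t.1 (q t) ≠ r t) :
    (checked q r e).output x O = none := by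
  rw [output_checked, if_pos ((checkedVal_out_true q r e x O).mpr hq)]

end OracleCircuit

/-! ### The inclusion -/

/-- One oracle serves each entry of the array of isolated functions; their certificates are
hard-wired, which is where nonuniformity enters. -/
theorem exists_checking_circuit {n k : ℕ} (V : Language Bool) (a₀ : Fin k → Bool) :
    ∃ U : OracleCircuit n ((n + 1) * (n + 1)), U.depth ≤ 3 ∧
      U.size = 4 + n + (n + 1) * (n + 1) +
        2 * ((n + 1) * (n + 1) * (2 * ((2 * n + 2) * (k + 1)) + k)) + (n + 1) ∧
      (∃ a : Fin ((n + 1) * (n + 1)) → Fin k → Bool, ∀ x : Fin n → Bool,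
        U.output x (fun j => withAdvice V (a j)) = some (withAdvice V a₀ x)) ∧
      ∀ (a : Fin ((n + 1) * (n + 1)) → Fin k → Bool) (x : Fin n → Bool),
        U.output x (fun j => withAdvice V (a j)) = some (withAdvice V a₀ x) ∨
        U.output x (fun j => withAdvice V (a j)) = none := by
  obtain ⟨a, hiso, ha⟩ := exists_disjunction_of_conjunctions
    (fun (w : Fin k → Bool) (x : Fin n → Bool) => withAdvice V w x) a₀ (n := n) (k := k)
    (by simp) (by simp)
  choose q hq using fun i j => (hiso i j).exists_queries
  let ij : Fin ((n + 1) * (n + 1)) → Fin (n + 1) × Fin (n + 1) := finProdFinEquiv.symm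
  let e : Fin (n + 1) → Fin (n + 1) → Fin ((n + 1) * (n + 1)) := fun i j => finProdFinEquiv (i, j)
  let A : Fin ((n + 1) * (n + 1)) → Fin k → Bool := fun u => a (ij u).1 (ij u).2
  have hA : ∀ i j, A (e i j) = a i j := fun i j => by
    simp only [A, e, ij, Equiv.symm_apply_apply]
  let Q : Fin ((n + 1) * (n + 1)) × Fin (2 * ((2 * n + 2) * (k + 1)) + k) → Fin n → Bool :=
    fun t => q (ij t.1).1 (ij t.1).2 t.2
  let R : Fin ((n + 1) * (n + 1)) × Fin (2 * ((2 * n + 2) * (k + 1)) + k) → Bool :=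
    fun t => withAdvice V (A t.1) (Q t)
  refine ⟨OracleCircuit.checked Q R e, OracleCircuit.depth_checked _ _ _,
    OracleCircuit.size_checked _ _ _, ⟨A, fun x => ?_⟩, fun b x => ?_⟩
  · refine OracleCircuit.output_checked_of_forall _ _ _ _ _ (fun _ => rfl) ?_
    simpa only [hA] using ha x
  · by_cases hb : ∀ t : Fin ((n + 1) * (n + 1)) × Fin (2 * ((2 * n + 2) * (k + 1)) + k),
        withAdvice V (b t.1) (Q t) = R t
    -- The advice strings `b u` and `A u` may differ, but passing the tests forces them to compute
    -- the same function.
    · have hbA : ∀ u, (fun x : Fin n → Bool => withAdvice V (b u) x) =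
          fun x => withAdvice V (A u) x :=
        fun u => hq (ij u).1 (ij u).2 (b u) fun t => hb (u, t)
      left
      refine OracleCircuit.output_checked_of_forall _ _ _ _ _ hb ?_
      rw [ha x]
      refine exists_congr fun i => forall_congr' fun j => ?_
      rw [← hA, congrFun (hbA (e i j)) x]
    · push Not at hb
      exact Or.inr (OracleCircuit.output_checked_of_exists _ _ _ _ _ hb)

theorem slashPoly_subset_AC0Untrusted (𝒞 : Set (Language Bool)) :
    slashPoly 𝒞 ⊆ AC0Untrusted 𝒞 := by
  classical
  rintro L ⟨V, hV, p, a, hL⟩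
  choose U hdepth hsize hcomplete hsound using
    fun n => exists_checking_circuit (n := n) V (a n)
  have hdec : ∀ (n : ℕ) (x : Fin n → Bool),
      withAdvice V (a n) x = decide (List.ofFn x ∈ L) := fun n x => by
    rw [Bool.eq_iff_iff, hL, decide_eq_true_eq]
  refine ⟨fun n => (n + 1) * (n + 1), U, 3,
    -- The exact size of the circuit, with the advice length `k` replaced by `p`.
    4 + .X + (.X + 1) * (.X + 1) +
      2 * ((.X + 1) * (.X + 1) * (2 * ((2 * .X + 2) * (p + 1)) + p)) + (.X + 1),
    fun n => ⟨hdepth n, ?_⟩, V, hV, p, fun n => ⟨?_, ?_⟩⟩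
  · rw [hsize]
    simp
  · obtain ⟨b, hb⟩ := hcomplete n
    refine ⟨b, fun x => ?_⟩
    rw [hb x, hdec]
  · intro b x
    have h := hsound n b x
    rw [hdec] at h
    convert h

end UntrustedOracles

theorem mainTheorem12 :
    (∀ 𝒞 : Set (Language Bool),
      UntrustedOracles.slashPoly 𝒞 ⊆ UntrustedOracles.AC0Untrusted 𝒞) ∧
    UntrustedOracles.slashPoly UntrustedOracles.P ⊆
      UntrustedOracles.AC0Untrusted UntrustedOracles.P ∧
    UntrustedOracles.slashPoly UntrustedOracles.NP ⊆
      UntrustedOracles.AC0Untrusted UntrustedOracles.NP ∧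
    UntrustedOracles.slashPoly UntrustedOracles.EXP ⊆
      UntrustedOracles.AC0Untrusted UntrustedOracles.EXP :=
  ⟨UntrustedOracles.slashPoly_subset_AC0Untrusted,
    UntrustedOracles.slashPoly_subset_AC0Untrusted _,
    UntrustedOracles.slashPoly_subset_AC0Untrusted _,
    UntrustedOracles.slashPoly_subset_AC0Untrusted _⟩
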